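/- Let $\mathcal A$ be a Desargues affine plane, that is, a set of points together with a set of lines (each line being a set of points) such that any two distinct points lie on exactly one line, through every point off a line there passes exactly one line disjoint from it (Playfair), there exist three non-collinear points, and Desargues' axiom holds in both its parallel and its concurrent form: if the distinct lines $AA'$, $BB'$, $CC'$ are parallel or meet in exactly one point, and $AB\parallel A'B'$ and $BC\parallel B'C'$, then $AC\parallel A'C'$. Let $O\ne I$ be two points and let $\ell^{OI}$ be the line through them. For $A,B\in\ell^{OI}$ the sum and the product are defined by the following constructions, which do not depend on the auxiliary point $E\notin\ell^{OI}$: let $P_1$ be the intersection of the parallel to $\ell^{OI}$ through $E$ with the parallel to $OE$ through $A$; then $A+B$ is the intersection of $\ell^{OI}$ with the parallel to $BE$ through $P_1$. Let $P_1$ be the intersection of $OE$ with the parallel to $IE$ through $A$; then $A\cdot B$ is the intersection of $\ell^{OI}$ with the parallel to $BE$ through $P_1$. Let $-A$ be the unique point of $\ell^{OI}$ with $A+(-A)=O$, put $A-C=A+(-C)$, and, for $A\neq O$, let $A^{-1}$ be the unique point of $\ell^{OI}$ with $A\cdot A^{-1}=I$. For $A,B,C\in\ell^{OI}$ with $B\ne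 C$ define the ratio $$r(A,B;C)=(B-C)^{-1}\cdot(A-C)\in\ell^{OI}.$$ For $P\in\ell^{OI}$ let $\varphi_P:\ell^{OI}\to\ell^{OI}$, $\varphi_P(A)=P+A$, be the natural translation with the point $P$. Then for all $P,A,B,C\in\ell^{OI}$ with $B\neq C$ one has $\varphi_P(B)\ne\varphi_P(C)$ and $$r\bigl(\varphi_P(A),\varphi_P(B);\varphi_P(C)\bigr)=r(A,B;C).$$ -/

import Mathlib

universe u

/-- An affine plane: a set of points `α` and a set of lines, each line being a set of points. -/
structure AffinePlane (α : Type u) where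
  lines : Set (Set α)
  /-- Through two distinct points there is exactly one line. -/
  join : ∀ P Q : α, P ≠ Q → ∃! k : Set α, k ∈ lines ∧ P ∈ k ∧ Q ∈ k
  /-- Playfair's axiom. -/
  playfair : ∀ (P : α) (k : Set α), k ∈ lines → P ∉ k →
    ∃! k' : Set α, k' ∈ lines ∧ P ∈ k' ∧ k ∩ k' = ∅
  /-- There are three non-collinear points. -/
  noncollinear : ∃ P Q R : α, P ≠ Q ∧ Q ≠ R ∧ P ≠ R ∧
    ∀ k ∈ lines, ¬ (P ∈ k ∧ Q ∈ k ∧ R ∈ k)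

namespace AffinePlane

variable {α : Type u}

/-- Two lines are parallel if they are equal or have no common point. -/
def Parallel (k k' : Set α) : Prop := k = k' ∨ k ∩ k' = ∅

/-- `k` is the line joining the two distinct points `P` and `Q`. -/
def Joins (𝒜 : AffinePlane α) (k : Set α) (P Q : α) : Prop :=
  k ∈ 𝒜.lines ∧ P ≠ Q ∧ P ∈ k ∧ Q ∈ k

/-- `k'` is the line through the point `P` parallel to `k`. -/
def ParallelAt (𝒜 : AffinePlane α) (k' : Set α) (P : α) (k : Set α) : Prop :=
  k' ∈ 𝒜.lines ∧ P ∈ k' ∧ Parallel k' k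

/-- Desargues' axiom, in both its forms (the lines `AA'`, `BB'`, `CC'` are parallel, or they meet
in exactly one point): if `AB ∥ A'B'` and `BC ∥ B'C'` then `AC ∥ A'C'`. -/
def Desargues (𝒜 : AffinePlane α) : Prop :=
  ∀ (A B C A' B' C' : α) (a b c ab ab' bc bc' ac ac' : Set α),
    𝒜.Joins a A A' → 𝒜.Joins b B B' → 𝒜.Joins c C C' →
    𝒜.Joins ab A B → 𝒜.Joins ab' A' B' →
    𝒜.Joins bc B C → 𝒜.Joins bc' B' C' →
    𝒜.Joins ac A C → 𝒜.Joins ac' A' C' →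
    [a, b, c, ac, ac'].Nodup → ab ≠ ab' → bc ≠ bc' →
    ((Parallel a b ∧ Parallel b c ∧ Parallel a c) ∨ ∃ P : α, a ∩ b ∩ c = {P}) →
    Parallel ab ab' → Parallel bc bc' → Parallel ac ac'

/-- Addition algorithm on the line `l` with origin `O`, with auxiliary point `E` off `l`: let `P₁`
be the intersection of the parallel to `l` through `E` with the parallel to `OE` through `A`; the
sum of `A` and `B` is the intersection `C` of `l` with the parallel to `BE` through `P₁`. -/
def IsSumAt (𝒜 : AffinePlane α) (l : Set α) (O E A B C : α) : Prop :=
  ∃ (P₁ : α) (m oe a be p : Set α),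
    𝒜.ParallelAt m E l ∧ 𝒜.Joins oe O E ∧ 𝒜.ParallelAt a A oe ∧ P₁ ∈ m ∩ a ∧
    𝒜.Joins be B E ∧ 𝒜.ParallelAt p P₁ be ∧ C ∈ p ∩ l

/-- `C` is obtained from `A` and `B` by the addition algorithm, for some auxiliary point. -/
def IsSum (𝒜 : AffinePlane α) (l : Set α) (O A B C : α) : Prop :=
  ∃ E, E ∉ l ∧ 𝒜.IsSumAt l O E A B C

/-- Multiplication algorithm on the line `l` with origin `O` and unit `I`, with auxiliary point `E`
off `l`: let `P₁` be the intersection of the line `OE` with the parallel to `IE` through `A`; the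
product of `A` and `B` is the intersection `C` of `l` with the parallel to `BE` through `P₁`. -/
def IsProdAt (𝒜 : AffinePlane α) (l : Set α) (O I E A B C : α) : Prop :=
  ∃ (P₁ : α) (oe ie a be p : Set α),
    𝒜.Joins ie I E ∧ 𝒜.ParallelAt a A ie ∧ 𝒜.Joins oe O E ∧ P₁ ∈ a ∩ oe ∧
    𝒜.Joins be B E ∧ 𝒜.ParallelAt p P₁ be ∧ C ∈ p ∩ l

/-- `C` is obtained from `A` and `B` by the multiplication algorithm, for some auxiliary point. -/
def IsProd (𝒜 : AffinePlane α) (l : Set α) (O I A B C : α) : Prop :=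
  ∃ E, E ∉ l ∧ 𝒜.IsProdAt l O I E A B C

section basics

variable (𝒜 : AffinePlane α)

theorem line_eq {k k' : Set α} {P Q : α} (hk : k ∈ 𝒜.lines) (hk' : k' ∈ 𝒜.lines) (h : P ≠ Q)
    (h1 : P ∈ k) (h2 : Q ∈ k) (h3 : P ∈ k') (h4 : Q ∈ k') : k = k' :=
  (𝒜.join P Q h).unique ⟨hk, h1, h2⟩ ⟨hk', h3, h4⟩

theorem exists_line {P Q : α} (h : P ≠ Q) : ∃ k, 𝒜.Joins k P Q := by
  obtain ⟨k, ⟨h1, h2, h3⟩, -⟩ := 𝒜.join P Q h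
  exact ⟨k, h1, h, h2, h3⟩

theorem par_refl (k : Set α) : Parallel k k := Or.inl rfl

theorem par_symm {k k' : Set α} (h : Parallel k k') : Parallel k' k := by
  rcases h with h | h
  · exact Or.inl h.symm
  · right; rw [Set.inter_comm]; exact h

theorem par_eq {k k' : Set α} {P : α} (h : Parallel k k') (h1 : P ∈ k) (h2 : P ∈ k') :
    k = k' := by
  rcases h with h | h
  · exact h
  · exact absurd (show P ∈ k ∩ k' from ⟨h1, h2⟩) (by simp [h])

theorem par_trans {k k' k'' : Set α} (hk : k ∈ 𝒜.lines) (hk' : k' ∈ 𝒜.lines)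
    (hk'' : k'' ∈ 𝒜.lines) (h : Parallel k k') (h' : Parallel k' k'') : Parallel k k'' := by
  by_cases hX : k ∩ k'' = ∅
  · exact Or.inr hX
  · obtain ⟨X, hX1, hX2⟩ := Set.nonempty_iff_ne_empty.2 hX
    by_cases hX' : X ∈ k'
    · left; rw [par_eq h hX1 hX', par_eq h' hX' hX2]
    · left
      refine (𝒜.playfair X k' hk' hX').unique ⟨hk, hX1, ?_⟩ ⟨hk'', hX2, ?_⟩
      · rcases h with h | h
        · exact absurd (h ▸ hX1) hX'
        · rw [Set.inter_comm]; exact h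
      · rcases h' with h | h
        · exact absurd (h ▸ hX2) hX'
        · exact h

theorem exists_parallelAt {k : Set α} (hk : k ∈ 𝒜.lines) (P : α) : ∃ k', 𝒜.ParallelAt k' P k := by
  by_cases h : P ∈ k
  · exact ⟨k, hk, h, par_refl k⟩
  · obtain ⟨k', ⟨h1, h2, h3⟩, -⟩ := 𝒜.playfair P k hk h
    exact ⟨k', h1, h2, par_symm (Or.inr h3)⟩

theorem exists_meet {k k' : Set α} (h : ¬ Parallel k k') : ∃ X, X ∈ k ∧ X ∈ k' := by
  by_contra hX
  exact h (Or.inr (Set.eq_empty_iff_forall_notMem.2 fun X hX' => hX ⟨X, hX'⟩))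

theorem exists_off {l : Set α} (hl : l ∈ 𝒜.lines) : ∃ E, E ∉ l := by
  obtain ⟨P, Q, R, -, -, -, h⟩ := 𝒜.noncollinear
  by_contra! hE
  exact h l hl ⟨hE P, hE Q, hE R⟩

/-- The lines `PQ` and `RS` are parallel. -/
def PPar (P Q R S : α) : Prop :=
  ∃ k k' : Set α, k ∈ 𝒜.lines ∧ k' ∈ 𝒜.lines ∧ P ∈ k ∧ Q ∈ k ∧ R ∈ k' ∧ S ∈ k' ∧ Parallel k k'

variable {𝒜}

theorem PPar.symm {P Q R S : α} (h : 𝒜.PPar P Q R S) : 𝒜.PPar R S P Q := by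
  obtain ⟨k, k', a, b, c, d, e, f, g⟩ := h
  exact ⟨k', k, b, a, e, f, c, d, par_symm g⟩

theorem PPar.swap {P Q R S : α} (h : 𝒜.PPar P Q R S) : 𝒜.PPar Q P S R := by
  obtain ⟨k, k', a, b, c, d, e, f, g⟩ := h
  exact ⟨k, k', a, b, d, c, f, e, g⟩

theorem PPar.unfold {P Q R S : α} (h : 𝒜.PPar P Q R S) {k k' : Set α} (hk : k ∈ 𝒜.lines)
    (hk' : k' ∈ 𝒜.lines) (hPQ : P ≠ Q) (hRS : R ≠ S) (h1 : P ∈ k) (h2 : Q ∈ k) (h3 : R ∈ k')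
    (h4 : S ∈ k') : Parallel k k' := by
  obtain ⟨j, j', a, b, c, d, e, f, g⟩ := h
  rw [𝒜.line_eq hk a hPQ h1 h2 c d, 𝒜.line_eq hk' b hRS h3 h4 e f]
  exact g

theorem PPar.unfold_left {P Q R S : α} (h : 𝒜.PPar P Q R S) {k k' : Set α} (hk : k ∈ 𝒜.lines)
    (hk' : k' ∈ 𝒜.lines) (hPQ : P ≠ Q) (h1 : P ∈ k) (h2 : Q ∈ k) (h3 : R ∈ k')
    (hp : Parallel k k') : S ∈ k' := by
  obtain ⟨j, j', a, b, c, d, e, f, g⟩ := h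
  have := 𝒜.line_eq hk a hPQ h1 h2 c d
  subst this
  rw [par_eq (𝒜.par_trans hk' hk b (par_symm hp) g) h3 e]
  exact f

end basics

end AffinePlane

namespace AffinePlane

section wellDefined

variable {α : Type u} {𝒜 : AffinePlane α}

/-- A pencil of lines: all lines through a point `O` (then `Z = {O}`) or all lines parallel to a
given line (then `Z = ∅`). -/
structure IsPencil (𝒜 : AffinePlane α) (S : Set (Set α)) (Z : Set α) : Prop where
  sub : ∀ k ∈ S, k ∈ 𝒜.lines
  inter : ∀ k ∈ S, ∀ k' ∈ S, k ≠ k' → k ∩ k' = Z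
  type : (∀ k ∈ S, ∀ k' ∈ S, Parallel k k') ∨ ∃ O, Z = {O}
  cover : ∀ X, X ∉ Z → ∃ k ∈ S, X ∈ k
  zsub : ∀ k ∈ S, Z ⊆ k

theorem isPencil_point (𝒜 : AffinePlane α) (O : α) :
    𝒜.IsPencil {k | k ∈ 𝒜.lines ∧ O ∈ k} {O} where
  sub := fun k hk => hk.1
  inter := by
    rintro k ⟨hk, hO⟩ k' ⟨hk', hO'⟩ hne
    ext X
    simp only [Set.mem_inter_iff, Set.mem_singleton_iff]
    constructor
    · rintro ⟨h1, h2⟩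
      by_contra hX
      exact hne (𝒜.line_eq hk hk' hX h1 hO h2 hO')
    · rintro rfl; exact ⟨hO, hO'⟩
  type := Or.inr ⟨O, rfl⟩
  cover := by
    intro X hX
    obtain ⟨k, h1, h2, h3, h4⟩ := 𝒜.exists_line (P := X) (Q := O) (by simpa using hX)
    exact ⟨k, ⟨h1, h4⟩, h3⟩
  zsub := by
    rintro k ⟨hk, hO⟩ X rfl
    exact hO

theorem isPencil_parallel (𝒜 : AffinePlane α) {l : Set α} (hl : l ∈ 𝒜.lines) :
    𝒜.IsPencil {k | k ∈ 𝒜.lines ∧ Parallel k l} ∅ where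
  sub := fun k hk => hk.1
  inter := by
    rintro k ⟨hk, hO⟩ k' ⟨hk', hO'⟩ hne
    rcases 𝒜.par_trans hk hl hk' hO (par_symm hO') with h | h
    · exact absurd h hne
    · exact h
  type := by
    left
    rintro k ⟨hk, hO⟩ k' ⟨hk', hO'⟩
    exact 𝒜.par_trans hk hl hk' hO (par_symm hO')
  cover := by
    intro X _
    obtain ⟨k, h1, h2, h3⟩ := 𝒜.exists_parallelAt hl X
    exact ⟨k, ⟨h1, h3⟩, h2⟩
  zsub := by simp

variable {S : Set (Set α)} {Z : Set α}

theorem IsPencil.notMem (hS : 𝒜.IsPencil S Z) {a b : Set α} {A : α} (ha : a ∈ S) (hb : b ∈ S)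
    (hab : a ≠ b) (hA : A ∈ a) (hAZ : A ∉ Z) : A ∉ b := fun h =>
  hAZ (hS.inter a ha b hb hab ▸ ⟨hA, h⟩)

theorem IsPencil.fix (hS : 𝒜.IsPencil S Z) {a b : Set α} {A B B' : α} (ha : a ∈ S) (hb : b ∈ S)
    (hab : a ≠ b) (hA : A ∈ a) (hAZ : A ∉ Z) (hB : B ∈ b) (hB' : B' ∈ b)
    (h : 𝒜.PPar A B A B') : B = B' := by
  by_contra hne
  obtain ⟨k, k', hk, hk', h1, h2, h3, h4, h5⟩ := h
  have := par_eq h5 h1 h3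
  subst this
  have := 𝒜.line_eq hk (hS.sub b hb) hne h2 h4 hB hB'
  subst this
  exact hS.notMem ha hb hab hA hAZ h1

theorem IsPencil.desargues (hS : 𝒜.IsPencil S Z) (hD : 𝒜.Desargues)
    {a b c : Set α} {A B C A' B' C' : α} (ha : a ∈ S) (hb : b ∈ S) (hc : c ∈ S)
    (hab : a ≠ b) (hbc : b ≠ c) (hac : a ≠ c) (hA : A ∈ a) (hA' : A' ∈ a) (hB : B ∈ b)
    (hB' : B' ∈ b) (hC : C ∈ c) (hC' : C' ∈ c) (zA : A ∉ Z) (zA' : A' ∉ Z) (zB : B ∉ Z)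
    (zB' : B' ∉ Z) (zC : C ∉ Z) (zC' : C' ∉ Z)
    (h1 : 𝒜.PPar A B A' B') (h2 : 𝒜.PPar B C B' C') : 𝒜.PPar A C A' C' := by
  have nAb := hS.notMem ha hb hab hA zA
  have nA'b := hS.notMem ha hb hab hA' zA'
  have nBa := hS.notMem hb ha hab.symm hB zB
  have nBc := hS.notMem hb hc hbc hB zB
  have nB'c := hS.notMem hb hc hbc hB' zB'
  have nCa := hS.notMem hc ha hac.symm hC zC
  have nC'a := hS.notMem hc ha hac.symm hC' zC'
  have nAc := hS.notMem ha hc hac hA zA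
  have nA'c := hS.notMem ha hc hac hA' zA'
  have neAC : A ≠ C := fun h => nAc (h ▸ hC)
  have neAC' : A' ≠ C' := fun h => nA'c (h ▸ hC')
  have neAB : A ≠ B := fun h => nAb (h ▸ hB)
  have neAB' : A' ≠ B' := fun h => nA'b (h ▸ hB')
  have neBC : B ≠ C := fun h => nBc (h ▸ hC)
  have neBC' : B' ≠ C' := fun h => nB'c (h ▸ hC')
  obtain ⟨ac, jac⟩ := 𝒜.exists_line neAC
  by_cases hAA : A = A'
  · subst hAA
    have := hS.fix ha hb hab hA zA hB hB' h1
    subst this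
    have := hS.fix hb hc hbc hB zB hC hC' h2
    subst this
    exact ⟨ac, ac, jac.1, jac.1, jac.2.2.1, jac.2.2.2, jac.2.2.1, jac.2.2.2, par_refl _⟩
  have hBB : B ≠ B' := by
    rintro rfl
    exact hAA (hS.fix hb ha hab.symm hB zB hA hA' h1.swap)
  have hCC : C ≠ C' := by
    rintro rfl
    exact hBB (hS.fix hc hb hbc.symm hC zC hB hB' h2.swap)
  obtain ⟨ac', jac'⟩ := 𝒜.exists_line neAC'
  refine ⟨ac, ac', jac.1, jac'.1, jac.2.2.1, jac.2.2.2, jac'.2.2.1, jac'.2.2.2, ?_⟩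
  by_cases hacac : ac = ac'
  · exact Or.inl hacac
  obtain ⟨ab, ab', lab, lab', p1, p2, p3, p4, p5⟩ := h1
  obtain ⟨bc, bc', lbc, lbc', q1, q2, q3, q4, q5⟩ := h2
  refine hD A B C A' B' C' a b c ab ab' bc bc' ac ac' ⟨hS.sub a ha, hAA, hA, hA'⟩
    ⟨hS.sub b hb, hBB, hB, hB'⟩ ⟨hS.sub c hc, hCC, hC, hC'⟩ ⟨lab, neAB, p1, p2⟩
    ⟨lab', neAB', p3, p4⟩ ⟨lbc, neBC, q1, q2⟩ ⟨lbc', neBC', q3, q4⟩ jac jac' ?_ ?_ ?_ ?_ p5 q5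
  · have e1 : a ≠ ac := fun h => nCa (h ▸ jac.2.2.2)
    have e2 : a ≠ ac' := fun h => nC'a (h ▸ jac'.2.2.2)
    have e3 : b ≠ ac := fun h => nAb (h ▸ jac.2.2.1)
    have e4 : b ≠ ac' := fun h => nA'b (h ▸ jac'.2.2.1)
    have e5 : c ≠ ac := fun h => nAc (h ▸ jac.2.2.1)
    have e6 : c ≠ ac' := fun h => nA'c (h ▸ jac'.2.2.1)
    simp [*]
  · rintro rfl
    have := 𝒜.line_eq lab (hS.sub a ha) hAA p1 p3 hA hA'
    exact nBa (this ▸ p2)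
  · rintro rfl
    have := 𝒜.line_eq lbc (hS.sub b hb) hBB q1 q3 hB hB'
    subst this
    exact hS.notMem hc hb hbc.symm hC zC q2
  · rcases hS.type with h | ⟨O, hO⟩
    · exact Or.inl ⟨h a ha b hb, h b hb c hc, h a ha c hc⟩
    · right
      refine ⟨O, ?_⟩
      rw [hS.inter a ha b hb hab, ← hO]
      exact Set.inter_eq_left.2 (hS.zsub c hc)

/-- The image of `H` under the perspectivity that sends `X` to `X'`. -/
theorem IsPencil.exists_image (hS : 𝒜.IsPencil S Z) {l h : Set α} {X X' H : α} (hl : l ∈ S)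
    (hh : h ∈ S) (hlh : l ≠ h) (hX : X ∈ l) (hX' : X' ∈ l) (hH : H ∈ h) (zX : X ∉ Z)
    (zX' : X' ∉ Z) (zH : H ∉ Z) : ∃ H' ∈ h, H' ∉ Z ∧ 𝒜.PPar X H X' H' := by
  have nXh := hS.notMem hl hh hlh hX zX
  have nHl := hS.notMem hh hl hlh.symm hH zH
  obtain ⟨k, hk, hne, k1, k2⟩ := 𝒜.exists_line (P := X) (Q := H) (fun e => nXh (e ▸ hH))
  obtain ⟨k', hk', k1', hp⟩ := 𝒜.exists_parallelAt hk X'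
  have hnp : ¬ Parallel k' h := by
    intro hp'
    have := par_eq (𝒜.par_trans hk hk' (hS.sub h hh) (par_symm hp) hp') k2 hH
    subst this
    exact nXh k1
  obtain ⟨H', h1, h2⟩ := exists_meet hnp
  refine ⟨H', h2, ?_, k, k', hk, hk', k1, k2, k1', h1, par_symm hp⟩
  intro hz
  have := 𝒜.line_eq hk' (hS.sub l hl) (fun e : X' = H' => zX' (by rw [e]; exact hz)) k1' h1 hX' (hS.zsub l hl hz)
  subst this
  have := par_eq hp hX k1
  subst this
  exact nHl k2

theorem IsPencil.transfer' (hS : 𝒜.IsPencil S Z) (hD : 𝒜.Desargues) {l f g : Set α}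
    {X X' Y Y' F F' G G' : α} (hl : l ∈ S) (hf : f ∈ S) (hg : g ∈ S) (hlf : l ≠ f) (hlg : l ≠ g)
    (hfg : f ≠ g) (hX : X ∈ l) (hX' : X' ∈ l) (hY : Y ∈ l) (hY' : Y' ∈ l) (hF : F ∈ f)
    (hF' : F' ∈ f) (hG : G ∈ g) (hG' : G' ∈ g) (zX : X ∉ Z) (zX' : X' ∉ Z) (zY : Y ∉ Z)
    (zY' : Y' ∉ Z) (zF : F ∉ Z) (zF' : F' ∉ Z) (zG : G ∉ Z) (zG' : G' ∉ Z)
    (h1 : 𝒜.PPar X F X' F') (h2 : 𝒜.PPar X G X' G') (h3 : 𝒜.PPar Y F Y' F') :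
    𝒜.PPar Y G Y' G' := by
  have h4 : 𝒜.PPar F G F' G' := hS.desargues hD hf hl hg hlf.symm hlg hfg hF hF' hX hX' hG hG'
    zF zF' zX zX' zG zG' h1.swap h2
  exact hS.desargues hD hl hf hg hlf hfg hlg hY hY' hF hF' hG hG' zY zY' zF zF' zG zG' h3 h4

theorem IsPencil.transfer (hS : 𝒜.IsPencil S Z) (hD : 𝒜.Desargues) {l f g : Set α}
    {X X' Y Y' F F' G G' : α} (hl : l ∈ S) (hf : f ∈ S) (hg : g ∈ S) (hlf : l ≠ f) (hlg : l ≠ g)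
    (hX : X ∈ l) (hX' : X' ∈ l) (hY : Y ∈ l) (hY' : Y' ∈ l) (hF : F ∈ f)
    (hF' : F' ∈ f) (hG : G ∈ g) (hG' : G' ∈ g) (zX : X ∉ Z) (zX' : X' ∉ Z) (zY : Y ∉ Z)
    (zY' : Y' ∉ Z) (zF : F ∉ Z) (zF' : F' ∉ Z) (zG : G ∉ Z) (zG' : G' ∉ Z)
    (hH : f = g → ∃ H, H ∉ Z ∧ H ∉ l ∧ H ∉ f)
    (h1 : 𝒜.PPar X F X' F') (h2 : 𝒜.PPar X G X' G') (h3 : 𝒜.PPar Y F Y' F') :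
    𝒜.PPar Y G Y' G' := by
  by_cases hfg : f = g
  · subst hfg
    obtain ⟨H, zH, nHl, nHf⟩ := hH rfl
    obtain ⟨h, hh, hHh⟩ := hS.cover H zH
    have hlh : l ≠ h := fun e => nHl (e ▸ hHh)
    have hfh : f ≠ h := fun e => nHf (e ▸ hHh)
    obtain ⟨H', hH', zH', h5⟩ := hS.exists_image hl hh hlh hX hX' hHh zX zX' zH
    have h6 := hS.transfer' hD hl hf hh hlf hlh hfh hX hX' hY hY' hF hF' hHh hH' zX zX' zY zY'
      zF zF' zH zH' h1 h5 h3
    exact hS.transfer' hD hl hh hf hlh hlf hfh.symm hX hX' hY hY' hHh hH' hG hG' zX zX' zY zY'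
      zH zH' zG zG' h5 h2 h6
  · exact hS.transfer' hD hl hf hg hlf hlg hfg hX hX' hY hY' hF hF' hG hG' zX zX' zY zY'
      zF zF' zG zG' h1 h2 h3

end wellDefined

end AffinePlane

namespace AffinePlane

section operations

variable {α : Type u} {𝒜 : AffinePlane α} {l : Set α} {O I E A B C X : α}

theorem ne_of_off (hX : X ∈ l) (hE : E ∉ l) : X ≠ E := fun h => hE (h ▸ hX)

theorem not_parallel_of_off {k : Set α} (hX : X ∈ l) (hE : E ∉ l) (hXk : X ∈ k) (hEk : E ∈ k) :
    ¬ Parallel k l := fun h => hE (par_eq h hXk hX ▸ hEk)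

/-- A line parallel to a line that is not parallel to `l` meets `l`. -/
theorem exists_meet_of_parallel {k k' : Set α} (hl : l ∈ 𝒜.lines) (hk : k ∈ 𝒜.lines)
    (hk' : k' ∈ 𝒜.lines) (hp : Parallel k' k) (h : ¬ Parallel k l) : ∃ X, X ∈ k' ∧ X ∈ l :=
  exists_meet fun h' => h (𝒜.par_trans hk hk' hl (par_symm hp) h')

theorem eq_of_ppar (hl : l ∈ 𝒜.lines) {P C' : α} (hB : B ∈ l) (hE : E ∉ l)
    (hC : C ∈ l) (hC' : C' ∈ l) (h : 𝒜.PPar B E C P) (h' : 𝒜.PPar B E C' P) : C = C' := by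
  by_contra hne
  obtain ⟨k, k', hk, hk', h1, h2, h3, h4, h5⟩ := h
  have h6 := h'.swap.unfold_left hk hk' (ne_of_off hB hE).symm h2 h1 h4 h5
  have := 𝒜.line_eq hk' hl hne h3 h6 hC hC'
  subst this
  exact not_parallel_of_off hB hE h1 h2 h5

theorem exists_ppar (hl : l ∈ 𝒜.lines) (hB : B ∈ l) (hE : E ∉ l) (P : α) :
    ∃ C ∈ l, 𝒜.PPar B E C P := by
  obtain ⟨k, hk, -, h1, h2⟩ := 𝒜.exists_line (ne_of_off hB hE)
  obtain ⟨k', hk', h3, h4⟩ := 𝒜.exists_parallelAt hk P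
  obtain ⟨C, h5, h6⟩ := exists_meet_of_parallel hl hk hk' h4 (not_parallel_of_off hB hE h1 h2)
  exact ⟨C, h6, k, k', hk, hk', h1, h2, h5, h3, par_symm h4⟩

theorem isSumAt_iff (hO : O ∈ l) (hB : B ∈ l) (hE : E ∉ l) :
    𝒜.IsSumAt l O E A B C ↔ C ∈ l ∧ ∃ m ∈ 𝒜.lines, ∃ P ∈ m, E ∈ m ∧ Parallel m l ∧
      𝒜.PPar O E A P ∧ 𝒜.PPar B E C P := by
  constructor
  · rintro ⟨P, m, oe, a, be, p, ⟨hm, hEm, hml⟩, ⟨hoe, -, o1, o2⟩, ⟨ha, a1, a2⟩, ⟨p1, p2⟩,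
      ⟨hbe, -, b1, b2⟩, ⟨hp, p3, p4⟩, p5, p6⟩
    exact ⟨p6, m, hm, P, p1, hEm, hml, ⟨oe, a, hoe, ha, o1, o2, a1, p2, par_symm a2⟩,
      be, p, hbe, hp, b1, b2, p5, p3, par_symm p4⟩
  · rintro ⟨hC, m, hm, P, hP, hEm, hml, ⟨oe, a, hoe, ha, o1, o2, a1, p2, a2⟩,
      be, p, hbe, hp, b1, b2, p5, p3, p4⟩
    exact ⟨P, m, oe, a, be, p, ⟨hm, hEm, hml⟩, ⟨hoe, ne_of_off hO hE, o1, o2⟩,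
      ⟨ha, a1, par_symm a2⟩, ⟨hP, p2⟩, ⟨hbe, ne_of_off hB hE, b1, b2⟩, ⟨hp, p3, par_symm p4⟩,
      p5, hC⟩

theorem isProdAt_iff (hO : O ∈ l) (hI : I ∈ l) (hB : B ∈ l) (hE : E ∉ l) :
    𝒜.IsProdAt l O I E A B C ↔ C ∈ l ∧ ∃ oe ∈ 𝒜.lines, ∃ P ∈ oe, O ∈ oe ∧ E ∈ oe ∧
      𝒜.PPar I E A P ∧ 𝒜.PPar B E C P := by
  constructor
  · rintro ⟨P, oe, ie, a, be, p, ⟨hie, -, i1, i2⟩, ⟨ha, a1, a2⟩, ⟨hoe, -, o1, o2⟩, ⟨p1, p2⟩,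
      ⟨hbe, -, b1, b2⟩, ⟨hp, p3, p4⟩, p5, p6⟩
    exact ⟨p6, oe, hoe, P, p2, o1, o2, ⟨ie, a, hie, ha, i1, i2, a1, p1, par_symm a2⟩,
      be, p, hbe, hp, b1, b2, p5, p3, par_symm p4⟩
  · rintro ⟨hC, oe, hoe, P, hP, o1, o2, ⟨ie, a, hie, ha, i1, i2, a1, p2, a2⟩,
      be, p, hbe, hp, b1, b2, p5, p3, p4⟩
    exact ⟨P, oe, ie, a, be, p, ⟨hie, ne_of_off hI hE, i1, i2⟩, ⟨ha, a1, par_symm a2⟩,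
      ⟨hoe, ne_of_off hO hE, o1, o2⟩, ⟨p2, hP⟩,
      ⟨hbe, ne_of_off hB hE, b1, b2⟩, ⟨hp, p3, par_symm p4⟩, p5, hC⟩

/-- The first step of the addition algorithm. -/
theorem exists_sumPoint (hl : l ∈ 𝒜.lines) (hO : O ∈ l) (hE : E ∉ l) (A : α) :
    ∃ m ∈ 𝒜.lines, ∃ P ∈ m, E ∈ m ∧ Parallel m l ∧ 𝒜.PPar O E A P := by
  obtain ⟨m, hm, hEm, hml⟩ := 𝒜.exists_parallelAt hl E
  obtain ⟨oe, hoe, -, o1, o2⟩ := 𝒜.exists_line (ne_of_off hO hE)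
  obtain ⟨a, ha, a1, a2⟩ := 𝒜.exists_parallelAt hoe A
  have h : ¬ Parallel oe m := fun h =>
    not_parallel_of_off hO hE o1 o2 (𝒜.par_trans hoe hm hl h hml)
  obtain ⟨P, p1, p2⟩ := exists_meet_of_parallel hm hoe ha a2 h
  exact ⟨m, hm, P, p2, hEm, hml, oe, a, hoe, ha, o1, o2, a1, p1, par_symm a2⟩

/-- The first step of the multiplication algorithm. -/
theorem exists_prodPoint (hl : l ∈ 𝒜.lines) (hO : O ∈ l) (hI : I ∈ l) (hOI : O ≠ I) (hE : E ∉ l)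
    (A : α) : ∃ oe ∈ 𝒜.lines, ∃ P ∈ oe, O ∈ oe ∧ E ∈ oe ∧ 𝒜.PPar I E A P := by
  obtain ⟨oe, hoe, -, o1, o2⟩ := 𝒜.exists_line (ne_of_off hO hE)
  obtain ⟨ie, hie, -, i1, i2⟩ := 𝒜.exists_line (ne_of_off hI hE)
  obtain ⟨a, ha, a1, a2⟩ := 𝒜.exists_parallelAt hie A
  have h : ¬ Parallel ie oe := fun h => by
    have := par_eq h i2 o2
    subst this
    exact hE (𝒜.line_eq hie hl hOI o1 i1 hO hI ▸ i2)
  obtain ⟨P, p1, p2⟩ := exists_meet_of_parallel hoe hie ha a2 h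
  exact ⟨oe, hoe, P, p2, o1, o2, ie, a, hie, ha, i1, i2, a1, p1, par_symm a2⟩

theorem exists_isSumAt (hl : l ∈ 𝒜.lines) (hO : O ∈ l) (hB : B ∈ l) (hE : E ∉ l) (A : α) :
    ∃ C, C ∈ l ∧ 𝒜.IsSumAt l O E A B C := by
  obtain ⟨m, hm, P, hP, h1, h2, h3⟩ := exists_sumPoint hl hO hE A
  obtain ⟨C, hC, h4⟩ := exists_ppar hl hB hE P
  exact ⟨C, hC, (isSumAt_iff hO hB hE).2 ⟨hC, m, hm, P, hP, h1, h2, h3, h4⟩⟩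

theorem exists_isProdAt (hl : l ∈ 𝒜.lines) (hO : O ∈ l) (hI : I ∈ l) (hOI : O ≠ I) (hB : B ∈ l)
    (hE : E ∉ l) (A : α) : ∃ C, C ∈ l ∧ 𝒜.IsProdAt l O I E A B C := by
  obtain ⟨m, hm, P, hP, h1, h2, h3⟩ := exists_prodPoint hl hO hI hOI hE A
  obtain ⟨C, hC, h4⟩ := exists_ppar hl hB hE P
  exact ⟨C, hC, (isProdAt_iff hO hI hB hE).2 ⟨hC, m, hm, P, hP, h1, h2, h3, h4⟩⟩

/-- If `A`, `O`, `C` are three points of `l`, then there is a point off `l` and off a given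
parallel to `l`. -/
theorem exists_off_off (hl : l ∈ 𝒜.lines) {m : Set α} (hm : m ∈ 𝒜.lines) (hml : Parallel m l)
    (hEm : E ∈ m) (hE : E ∉ l) (hO : O ∈ l) (hA : A ∈ l) (hC : C ∈ l) (hOA : O ≠ A) (hOC : O ≠ C)
    (hAC : A ≠ C) : ∃ H, H ∉ l ∧ H ∉ m := by
  have hd : ∀ X, X ∈ l → X ∉ m := fun X h1 h2 => hE (par_eq hml h2 h1 ▸ hEm)
  obtain ⟨ae, hae, -, a1, a2⟩ := 𝒜.exists_line (ne_of_off hA hE)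
  obtain ⟨oe, hoe, -, o1, o2⟩ := 𝒜.exists_line (ne_of_off hO hE)
  obtain ⟨c, hc, c1, c2⟩ := 𝒜.exists_parallelAt hae C
  have hcE : E ∉ c := fun h => by
    have := par_eq c2 h a2
    subst this
    exact hE (𝒜.line_eq hc hl hAC a1 c1 hA hC ▸ h)
  have h : ¬ Parallel ae oe := fun h => by
    have := par_eq h a2 o2
    subst this
    exact hE (𝒜.line_eq hae hl hOA o1 a1 hO hA ▸ a2)
  obtain ⟨H, h1, h2⟩ := exists_meet_of_parallel hoe hae hc c2 h
  refine ⟨H, fun hHl => ?_, fun hHm => ?_⟩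
  · have hHC : H = C := by
      by_contra hne
      exact not_parallel_of_off hA hE a1 a2
        (par_symm (𝒜.line_eq hc hl hne h1 c1 hHl hC ▸ c2))
    subst hHC
    exact hE (𝒜.line_eq hoe hl hOC o1 h2 hO hHl ▸ o2)
  · have hHE : H = E := by
      by_contra hne
      exact hd O hO (𝒜.line_eq hoe hm hne h2 o2 hHm hEm ▸ o1)
    subst hHE
    exact hcE h1

theorem sumAt_zero_left {A : α} {E C : α} (hl : l ∈ 𝒜.lines) (hO : O ∈ l) (hA : A ∈ l)
    (hE : E ∉ l) (h : 𝒜.IsSumAt l O E O A C) : C = A := by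
  obtain ⟨hC, m, hm, P, hP, h1, h2, h3, h4⟩ := (isSumAt_iff hO hA hE).1 h
  have hOm : O ∉ m := fun h => hE (par_eq h2 h hO ▸ h1)
  obtain ⟨k, k', hk, hk', k1, k2, k3, k4, k5⟩ := h3
  have := par_eq k5 k1 k3
  subst this
  have : E = P := by
    by_contra hne
    exact hOm (𝒜.line_eq hk hm hne k2 k4 h1 hP ▸ k1)
  subst this
  obtain ⟨j, hj, -, j1, j2⟩ := 𝒜.exists_line (ne_of_off hA hE)
  exact eq_of_ppar hl hA hE hC hA h4 ⟨j, j, hj, hj, j1, j2, j1, j2, par_refl j⟩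

theorem sumAt_eq_left_iff {A B : α} {E C : α} (hl : l ∈ 𝒜.lines) (hO : O ∈ l) (hB : B ∈ l)
    (hE : E ∉ l) (hA : A ∈ l) (h : 𝒜.IsSumAt l O E A B C) : C = A ↔ B = O := by
  obtain ⟨hC, m, hm, P, hP, h1, h2, h3, h4⟩ := (isSumAt_iff hO hB hE).1 h
  have hPl : P ∉ l := fun h => hE (par_eq h2 hP h ▸ h1)
  constructor
  · rintro rfl
    exact eq_of_ppar hl hC hPl hB hO h4.symm h3.symm
  · rintro rfl
    exact eq_of_ppar hl hO hE hC hA h4 h3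

theorem IsSum.unique {C' : α} (hD : 𝒜.Desargues) (hl : l ∈ 𝒜.lines) (hO : O ∈ l) (hA : A ∈ l)
    (hB : B ∈ l) (h : 𝒜.IsSum l O A B C) (h' : 𝒜.IsSum l O A B C') : C = C' := by
  obtain ⟨E, hE, h⟩ := h
  obtain ⟨F, hF, h'⟩ := h'
  by_cases hAO : O = A
  · subst hAO
    rw [sumAt_zero_left hl hO hB hE h, sumAt_zero_left hl hO hB hF h']
  by_cases hBO : B = O
  · rw [(sumAt_eq_left_iff hl hO hB hE hA h).2 hBO, (sumAt_eq_left_iff hl hO hB hF hA h').2 hBO]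
  have hCA := mt (sumAt_eq_left_iff hl hO hB hE hA h).1 hBO
  have hCA' := mt (sumAt_eq_left_iff hl hO hB hF hA h').1 hBO
  obtain ⟨hC, m, hm, P, hP, h1, h2, h3, h4⟩ := (isSumAt_iff hO hB hE).1 h
  obtain ⟨hC', n, hn, Q, hQ, h1', h2', h3', h4'⟩ := (isSumAt_iff hO hB hF).1 h'
  by_contra hne
  have hS := isPencil_parallel 𝒜 hl
  refine hne (eq_of_ppar hl hB hF hC hC' ?_ h4')
  refine hS.transfer hD (l := l) (f := m) (g := n) ⟨hl, par_refl l⟩ ⟨hm, h2⟩ ⟨hn, h2'⟩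
    (fun e => hE (e ▸ h1)) (fun e => hF (e ▸ h1')) hO hA hB hC h1 hP h1' hQ (by simp) (by simp)
    (by simp) (by simp) (by simp) (by simp) (by simp) (by simp) (fun e => ?_) h3 h3' h4
  subst e
  by_cases hCO : O = C
  · obtain ⟨H, n1, n2⟩ := exists_off_off hl hm h2 h1 hE hO hA hC' hAO
      (fun e => hne (hCO.symm.trans e)) (Ne.symm hCA')
    exact ⟨H, by simp, n1, n2⟩
  · obtain ⟨H, n1, n2⟩ := exists_off_off hl hm h2 h1 hE hO hA hC hAO hCO (Ne.symm hCA)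
    exact ⟨H, by simp, n1, n2⟩

/-- `P = O` in the multiplication algorithm exactly if `A = O`. -/
theorem prodPoint_eq_iff {oe : Set α} {P : α} (hl : l ∈ 𝒜.lines) (hO : O ∈ l) (hI : I ∈ l)
    (hOI : O ≠ I) (hE : E ∉ l) (hA : A ∈ l) (hoe : oe ∈ 𝒜.lines) (hP : P ∈ oe) (o1 : O ∈ oe)
    (o2 : E ∈ oe) (h : 𝒜.PPar I E A P) : P = O ↔ A = O := by
  obtain ⟨j, hj, -, j1, j2⟩ := 𝒜.exists_line (ne_of_off hI hE)
  obtain ⟨k, hk, k1, k2⟩ := 𝒜.exists_parallelAt hj O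
  have hOO : 𝒜.PPar I E O O := ⟨j, k, hj, hk, j1, j2, k1, k1, par_symm k2⟩
  constructor
  · rintro rfl
    exact eq_of_ppar hl hI hE hA hO h hOO
  · rintro rfl
    have hIoe : I ∉ oe := fun h' => hE (𝒜.line_eq hoe hl hOI o1 h' hO hI ▸ o2)
    exact eq_of_ppar hoe o2 hIoe hP o1 h.swap hOO.swap

theorem IsProd.unique {C' : α} (hD : 𝒜.Desargues) (hl : l ∈ 𝒜.lines) (hO : O ∈ l) (hI : I ∈ l)
    (hOI : O ≠ I) (hA : A ∈ l) (hB : B ∈ l) (h : 𝒜.IsProd l O I A B C)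
    (h' : 𝒜.IsProd l O I A B C') : C = C' := by
  obtain ⟨E, hE, h⟩ := h
  obtain ⟨F, hF, h'⟩ := h'
  obtain ⟨hC, m, hm, P, hP, h1, h2, h3, h4⟩ := (isProdAt_iff hO hI hB hE).1 h
  obtain ⟨hC', n, hn, Q, hQ, h1', h2', h3', h4'⟩ := (isProdAt_iff hO hI hB hF).1 h'
  have iP := prodPoint_eq_iff hl hO hI hOI hE hA hm hP h1 h2 h3
  have iQ := prodPoint_eq_iff hl hO hI hOI hF hA hn hQ h1' h2' h3'
  have key : ∀ {G R D : α}, G ∉ l → D ∈ l → R = O → 𝒜.PPar B G D R → D = O := by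
    rintro G R D hG hD' rfl hp
    obtain ⟨j, hj, -, j1, j2⟩ := 𝒜.exists_line (ne_of_off hB hG)
    obtain ⟨k, hk, k1, k2⟩ := 𝒜.exists_parallelAt hj R
    exact eq_of_ppar hl hB hG hD' hO hp ⟨j, k, hj, hk, j1, j2, k1, k1, par_symm k2⟩
  by_cases hAO : A = O
  · rw [key hE hC (iP.2 hAO) h4, key hF hC' (iQ.2 hAO) h4']
  have key2 : ∀ {G R D : α} {k : Set α}, G ∉ l → D ∈ l → k ∈ 𝒜.lines → R ∈ k → O ∈ k → G ∈ k →
      R ≠ O → 𝒜.PPar B G D R → (B = O ↔ D = O) := by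
    intro G R D k hG hD' hk hR hOk hGk hRO hp
    have hRl : R ∉ l := fun h => hG (𝒜.line_eq hk hl hRO hR hOk h hO ▸ hGk)
    constructor
    · rintro rfl
      exact eq_of_ppar hl hB hG hD' hB hp ⟨k, k, hk, hk, hOk, hGk, hOk, hR, par_refl k⟩
    · rintro rfl
      exact eq_of_ppar hl hD' hRl hB hD' hp.symm ⟨k, k, hk, hk, hOk, hR, hOk, hGk, par_refl k⟩
  have e1 := key2 hE hC hm hP h1 h2 (mt iP.1 hAO) h4
  have e2 := key2 hF hC' hn hQ h1' h2' (mt iQ.1 hAO) h4'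
  by_cases hBO : B = O
  · rw [e1.1 hBO, e2.1 hBO]
  have hS := isPencil_point 𝒜 O
  refine eq_of_ppar hl hB hF hC hC' ?_ h4'
  refine hS.transfer hD (l := l) (f := m) (g := n) ⟨hl, hO⟩ ⟨hm, h1⟩ ⟨hn, h1'⟩
    (fun e => hE (e ▸ h2)) (fun e => hF (e ▸ h2')) hI hA hB hC h2 hP h2' hQ ?_ ?_ ?_ ?_ ?_ ?_ ?_ ?_
    ?_ h3 h3' h4
  · exact hOI.symm
  · exact hAO
  · exact hBO
  · exact mt e1.2 hBO
  · exact (ne_of_off hO hE).symm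
  · exact mt iP.1 hAO
  · exact (ne_of_off hO hF).symm
  · exact mt iQ.1 hAO
  · intro _
    have hIm : I ∉ m := fun h' => hE (𝒜.line_eq hm hl hOI h1 h' hO hI ▸ h2)
    obtain ⟨j, hj, -, j1, j2⟩ := 𝒜.exists_line (ne_of_off hI hE)
    obtain ⟨k, hk, k1, k2⟩ := 𝒜.exists_parallelAt hj O
    obtain ⟨i, hi, i1, i2⟩ := 𝒜.exists_parallelAt hm I
    have hjm : ¬ Parallel j m := fun h => hIm (par_eq h j2 h2 ▸ j1)
    have hkm : ¬ Parallel k m := fun h => hjm (𝒜.par_trans hj hk hm (par_symm k2) h)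
    have hki : ¬ Parallel k i := fun h => hkm (𝒜.par_trans hk hi hm h i2)
    obtain ⟨H, n1, n2⟩ := exists_meet hki
    have hHm : H ∉ m := fun h => hIm (par_eq i2 n2 h ▸ i1)
    have hHO : H ≠ O := fun h => hHm (h ▸ h1)
    refine ⟨H, hHO, fun h => ?_, hHm⟩
    have := 𝒜.line_eq hk hl hHO n1 k1 h hO
    subst this
    exact hE (par_eq k2 hI j1 ▸ j2)

theorem existsUnique_sum (hD : 𝒜.Desargues) (hl : l ∈ 𝒜.lines) (hO : O ∈ l) (hA : A ∈ l)
    (hB : B ∈ l) : ∃! C, C ∈ l ∧ 𝒜.IsSum l O A B C := by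
  obtain ⟨E, hE⟩ := 𝒜.exists_off hl
  obtain ⟨C, hC, h⟩ := exists_isSumAt hl hO hB hE A
  exact ⟨C, ⟨hC, E, hE, h⟩, fun C' h' => IsSum.unique hD hl hO hA hB h'.2 ⟨E, hE, h⟩⟩

theorem existsUnique_prod (hD : 𝒜.Desargues) (hl : l ∈ 𝒜.lines) (hO : O ∈ l) (hI : I ∈ l)
    (hOI : O ≠ I) (hA : A ∈ l) (hB : B ∈ l) : ∃! C, C ∈ l ∧ 𝒜.IsProd l O I A B C := by
  obtain ⟨E, hE⟩ := 𝒜.exists_off hl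
  obtain ⟨C, hC, h⟩ := exists_isProdAt hl hO hI hOI hB hE A
  exact ⟨C, ⟨hC, E, hE, h⟩, fun C' h' => IsProd.unique hD hl hO hI hOI hA hB h'.2 ⟨E, hE, h⟩⟩

/-- The equation `A + X = C` has a unique solution. -/
theorem existsUnique_sub (hD : 𝒜.Desargues) (hl : l ∈ 𝒜.lines) (hO : O ∈ l) (hA : A ∈ l)
    (hC : C ∈ l) : ∃! X, X ∈ l ∧ 𝒜.IsSum l O A X C := by
  obtain ⟨E, hE⟩ := 𝒜.exists_off hl
  obtain ⟨m, hm, P, hP, h1, h2, h3⟩ := exists_sumPoint hl hO hE A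
  have hPl : P ∉ l := fun h => hE (par_eq h2 hP h ▸ h1)
  obtain ⟨X, hX, h4⟩ := exists_ppar hl hC hPl E
  refine ⟨X, ⟨hX, E, hE, (isSumAt_iff hO hX hE).2 ⟨hC, m, hm, P, hP, h1, h2, h3, h4.symm⟩⟩, ?_⟩
  rintro Y ⟨hY, hY'⟩
  obtain ⟨W, hW, h5⟩ := exists_ppar hl hY hE P
  have h6 : 𝒜.IsSumAt l O E A Y W := (isSumAt_iff hO hY hE).2 ⟨hW, m, hm, P, hP, h1, h2, h3, h5⟩
  have := IsSum.unique hD hl hO hA hY hY' ⟨E, hE, h6⟩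
  subst this
  exact eq_of_ppar hl hC hPl hY hX h5.symm h4

/-- The equation `A * X = C` with `A ≠ O` has a unique solution. -/
theorem existsUnique_div (hD : 𝒜.Desargues) (hl : l ∈ 𝒜.lines) (hO : O ∈ l) (hI : I ∈ l)
    (hOI : O ≠ I) (hA : A ∈ l) (hAO : A ≠ O) (hC : C ∈ l) :
    ∃! X, X ∈ l ∧ 𝒜.IsProd l O I A X C := by
  obtain ⟨E, hE⟩ := 𝒜.exists_off hl
  obtain ⟨m, hm, P, hP, h1, h2, h3⟩ := exists_prodPoint hl hO hI hOI hE A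
  have hPO : P ≠ O := mt (prodPoint_eq_iff hl hO hI hOI hE hA hm hP h1 h2 h3).1 hAO
  have hPl : P ∉ l := fun h => hE (𝒜.line_eq hm hl hPO hP h1 h hO ▸ h2)
  obtain ⟨X, hX, h4⟩ := exists_ppar hl hC hPl E
  refine ⟨X, ⟨hX, E, hE, (isProdAt_iff hO hI hX hE).2 ⟨hC, m, hm, P, hP, h1, h2, h3, h4.symm⟩⟩, ?_⟩
  rintro Y ⟨hY, hY'⟩
  obtain ⟨W, hW, h5⟩ := exists_ppar hl hY hE P
  have h6 : 𝒜.IsProdAt l O I E A Y W :=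
    (isProdAt_iff hO hI hY hE).2 ⟨hW, m, hm, P, hP, h1, h2, h3, h5⟩
  have := IsProd.unique hD hl hO hI hOI hA hY hY' ⟨E, hE, h6⟩
  subst this
  exact eq_of_ppar hl hC hPl hY hX h5.symm h4

/-- The solution `X` of `X + B = C` is unique. -/
theorem sum_right_cancel {A' : α} (hD : 𝒜.Desargues) (hl : l ∈ 𝒜.lines) (hO : O ∈ l) (hA : A ∈ l)
    (hA' : A' ∈ l) (hB : B ∈ l) (h : 𝒜.IsSum l O A B C) (h' : 𝒜.IsSum l O A' B C) : A = A' := by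
  obtain ⟨E, hE, h⟩ := h
  obtain ⟨W, hW, hE'⟩ := exists_isSumAt hl hO hB hE A'
  have := IsSum.unique hD hl hO hA' hB h' ⟨E, hE, hE'⟩
  subst this
  obtain ⟨hC, m, hm, P, hP, h1, h2, h3, h4⟩ := (isSumAt_iff hO hB hE).1 h
  obtain ⟨-, n, hn, Q, hQ, k1, k2, k3, k4⟩ := (isSumAt_iff hO hB hE).1 hE'
  have := par_eq (𝒜.par_trans hm hl hn h2 (par_symm k2)) h1 k1
  subst this
  have hBm : B ∉ m := fun h => hE (par_eq h2 h hB ▸ h1)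
  have := eq_of_ppar hm h1 hBm hP hQ h4.swap k4.swap
  subst this
  exact eq_of_ppar hl hO hE hA hA' h3 k3

end operations

end AffinePlane

/-- A Desargues affine plane: an affine plane satisfying Desargues' axiom. -/
structure DesarguesPlane (α : Type u) extends AffinePlane α where
  desargues : toAffinePlane.Desargues

/-- The line `ℓ^{OI}` in a Desargues affine plane, through two distinct points `O` (the zero point)
and `I` (the unit point). -/
structure OILine {α : Type u} (𝒜 : DesarguesPlane α) where
  O : α
  I : α
  line : Set α
  joins : 𝒜.Joins line O I

namespace OILine

variable {α : Type u} {𝒜 : DesarguesPlane α}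

/-- The points of the line `ℓ^{OI}`. -/
def Point (L : OILine 𝒜) : Type u := {X : α // X ∈ L.line}

variable {L : OILine 𝒜}

instance : Zero L.Point := ⟨⟨L.O, L.joins.2.2.1⟩⟩

instance : One L.Point := ⟨⟨L.I, L.joins.2.2.2⟩⟩

theorem existsUnique_add (A B : L.Point) :
    ∃! C : L.Point, 𝒜.IsSum L.line L.O A.1 B.1 C.1 := by
  obtain ⟨C, ⟨hC, h⟩, hu⟩ :=
    AffinePlane.existsUnique_sum 𝒜.desargues L.joins.1 L.joins.2.2.1 A.2 B.2
  exact ⟨⟨C, hC⟩, h, fun D hD => Subtype.ext (hu D.1 ⟨D.2, hD⟩)⟩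

theorem existsUnique_mul (A B : L.Point) :
    ∃! C : L.Point, 𝒜.IsProd L.line L.O L.I A.1 B.1 C.1 := by
  obtain ⟨C, ⟨hC, h⟩, hu⟩ := AffinePlane.existsUnique_prod 𝒜.desargues L.joins.1 L.joins.2.2.1
    L.joins.2.2.2 L.joins.2.1 A.2 B.2
  exact ⟨⟨C, hC⟩, h, fun D hD => Subtype.ext (hu D.1 ⟨D.2, hD⟩)⟩

/-- Addition of points: `A + B` is the point constructed by the addition algorithm. -/
noncomputable instance : Add L.Point := ⟨fun A B => (existsUnique_add A B).choose⟩

/-- Multiplication of points: `A * B` is the point constructed by the multiplication algorithm. -/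
noncomputable instance : Mul L.Point := ⟨fun A B => (existsUnique_mul A B).choose⟩

theorem add_spec (A B : L.Point) : 𝒜.IsSum L.line L.O A.1 B.1 (A + B).1 :=
  (existsUnique_add A B).choose_spec.1

theorem mul_spec (A B : L.Point) : 𝒜.IsProd L.line L.O L.I A.1 B.1 (A * B).1 :=
  (existsUnique_mul A B).choose_spec.1

theorem add_eq_iff (A B C : L.Point) : A + B = C ↔ 𝒜.IsSum L.line L.O A.1 B.1 C.1 :=
  ⟨fun h => h ▸ add_spec A B, fun h => (existsUnique_add A B).unique (add_spec A B) h⟩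

theorem mul_eq_iff (A B C : L.Point) : A * B = C ↔ 𝒜.IsProd L.line L.O L.I A.1 B.1 C.1 :=
  ⟨fun h => h ▸ mul_spec A B, fun h => (existsUnique_mul A B).unique (mul_spec A B) h⟩

theorem existsUnique_neg (A : L.Point) : ∃! X : L.Point, A + X = 0 := by
  obtain ⟨X, ⟨hX, h⟩, hu⟩ := AffinePlane.existsUnique_sub 𝒜.desargues L.joins.1 L.joins.2.2.1 A.2
    L.joins.2.2.1
  exact ⟨⟨X, hX⟩, (add_eq_iff _ _ _).2 h,
    fun Y hY => Subtype.ext (hu Y.1 ⟨Y.2, (add_eq_iff _ _ _).1 hY⟩)⟩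

theorem existsUnique_inv (A : L.Point) (hA : A ≠ 0) : ∃! X : L.Point, A * X = 1 := by
  obtain ⟨X, ⟨hX, h⟩, hu⟩ := AffinePlane.existsUnique_div 𝒜.desargues L.joins.1 L.joins.2.2.1
    L.joins.2.2.2 L.joins.2.1 A.2 (fun h => hA (Subtype.ext h)) L.joins.2.2.2
  exact ⟨⟨X, hX⟩, (mul_eq_iff _ _ _).2 h,
    fun Y hY => Subtype.ext (hu Y.1 ⟨Y.2, (mul_eq_iff _ _ _).1 hY⟩)⟩

/-- The opposite point `-A`, the unique point `X` with `A + X = 0`. -/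
noncomputable instance : Neg L.Point := ⟨fun A => (existsUnique_neg A).choose⟩

noncomputable instance : Sub L.Point := ⟨fun A B => A + -B⟩

/-- The inverse point of `A ≠ 0`, the unique point `X` with `A * X = 1`. -/
noncomputable def inv (A : L.Point) (hA : A ≠ 0) : L.Point := (existsUnique_inv A hA).choose

theorem add_neg_self (A : L.Point) : A + -A = 0 := (existsUnique_neg A).choose_spec.1

theorem sub_ne_zero_of_ne {B C : L.Point} (h : B ≠ C) : B - C ≠ 0 := fun h' =>
  h (Subtype.ext (AffinePlane.sum_right_cancel 𝒜.desargues L.joins.1 L.joins.2.2.1 B.2 C.2 (-C).2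
    ((add_eq_iff _ _ _).1 h') ((add_eq_iff _ _ _).1 (add_neg_self C))))

/-- The ratio of three points, `r(A, B; C) = (B - C)⁻¹ * (A - C)`, where `B ≠ C`. -/
noncomputable def ratio (A B C : L.Point) (h : B ≠ C) : L.Point :=
  inv (B - C) (sub_ne_zero_of_ne h) * (A - C)

/-- The natural translation with the point `P`. -/
noncomputable def naturalTranslation (P : L.Point) : L.Point → L.Point := fun A => P + A

end OILine

/-!
The ratio depends on `A`, `B`, `C` only through the differences `B - C` and `A - C`, so it is enough
that the addition of points makes the line `ℓ^{OI}` a commutative group: then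
`(P + A) - (P + C) = A - C`.

Fix a line `m` parallel to `ℓ^{OI}`. Two points `E`, `F` of `m` define the translation of `ℓ^{OI}`
that sends `X` to the point `Y` with `XE ∥ YF`, and `X ↦ A + X` is such a translation whenever
`OE ∥ AF`. Since the sum does not depend on the auxiliary point, the translation belonging to `B`
can be read off at the points `F`, `G` of `m`, starting where the translation belonging to `A` ends;
transitivity of parallelism then gives associativity (`OILine.point_add_assoc`).

For commutativity, choose `H` off the line. Then `X ↦ X + A` is the translation `O → H` followed by
the translation `H → A`. Moving a second auxiliary point `E` along with `O` through the same two
steps, three applications of the parallel form of Desargues' axiom show that the construction of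
`B + A` with `H` also is a construction of `A + B` with `E`
(`OILine.point_add_comm_of_exists`). The triangles involved are non-degenerate for all but four
positions of `E` on the parallel through `H`. If no other position exists, the line is so small
that commutativity follows from the group laws alone (`OILine.point_add_comm`).
-/

/-! ### Parallelism of pairs of points -/

namespace AffinePlane

variable {α : Type u} {𝒜 : AffinePlane α}

theorem PPar.trans {P Q R S T U : α} (h : 𝒜.PPar P Q R S) (h' : 𝒜.PPar R S T U) (hRS : R ≠ S) :
    𝒜.PPar P Q T U := by
  obtain ⟨j, j', hj, hj', a, b, c, d, e⟩ := h
  obtain ⟨k, k', hk, hk', a', b', c', d', e'⟩ := h'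
  have := 𝒜.line_eq hj' hk hRS c d a' b'
  subst this
  exact ⟨j, k', hj, hk', a, b, c', d', 𝒜.par_trans hj hj' hk' e e'⟩

theorem ppar_self {P Q : α} (h : P ≠ Q) : 𝒜.PPar P Q P Q := by
  obtain ⟨k, hk, -, h1, h2⟩ := 𝒜.exists_line h
  exact ⟨k, k, hk, hk, h1, h2, h1, h2, par_refl k⟩

/-- The parallel form of Desargues' axiom, allowing corresponding vertices to coincide. -/
theorem Desargues.of_parallel (hD : 𝒜.Desargues) {a b c : Set α} {A B C A' B' C' : α}
    (ha : a ∈ 𝒜.lines) (hb : b ∈ 𝒜.lines) (hc : c ∈ 𝒜.lines) (pba : Parallel b a)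
    (pca : Parallel c a) (hab : a ≠ b) (hbc : b ≠ c) (hac : a ≠ c) (hA : A ∈ a) (hA' : A' ∈ a)
    (hB : B ∈ b) (hB' : B' ∈ b) (hC : C ∈ c) (hC' : C' ∈ c)
    (h1 : 𝒜.PPar A B A' B') (h2 : 𝒜.PPar B C B' C') : 𝒜.PPar A C A' C' :=
  (isPencil_parallel 𝒜 ha).desargues hD ⟨ha, par_refl a⟩ ⟨hb, pba⟩ ⟨hc, pca⟩ hab hbc hac
    hA hA' hB hB' hC hC' (by simp) (by simp) (by simp) (by simp) (by simp) (by simp) h1 h2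

end AffinePlane

namespace OILine

open AffinePlane

variable {α : Type u} {𝒜 : DesarguesPlane α} {L : OILine 𝒜}

/-! ### The group laws -/

theorem zero_mem (L : OILine 𝒜) : L.O ∈ L.line := L.joins.2.2.1

theorem exists_mem_parallel {m : Set α} {E : α} (hm : m ∈ 𝒜.lines) (hml : Parallel m L.line)
    (hEm : E ∈ m) (hE : E ∉ L.line) (A : L.Point) : ∃ F ∈ m, 𝒜.PPar L.O E A.1 F := by
  obtain ⟨n, hn, F, hF, h1, h2, h3⟩ := exists_sumPoint L.joins.1 L.zero_mem hE A.1
  have := par_eq (𝒜.par_trans hn L.joins.1 hm h2 (par_symm hml)) h1 hEm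
  subst this
  exact ⟨F, hF, h3⟩

theorem add_eq_of_ppar {m : Set α} {E F : α} (hm : m ∈ 𝒜.lines) (hml : Parallel m L.line)
    (hEm : E ∈ m) (hE : E ∉ L.line) (hF : F ∈ m) {A B C : L.Point}
    (h1 : 𝒜.PPar L.O E A.1 F) (h2 : 𝒜.PPar B.1 E C.1 F) : A + B = C :=
  (add_eq_iff _ _ _).2
    ⟨E, hE, (isSumAt_iff L.zero_mem B.2 hE).2 ⟨C.2, m, hm, F, hF, hEm, hml, h1, h2⟩⟩

theorem ppar_add {m : Set α} {E F : α} (hm : m ∈ 𝒜.lines) (hml : Parallel m L.line)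
    (hEm : E ∈ m) (hE : E ∉ L.line) (hF : F ∈ m) {A : L.Point} (h1 : 𝒜.PPar L.O E A.1 F)
    (B : L.Point) : 𝒜.PPar B.1 E (A + B).1 F := by
  obtain ⟨C, hC, h⟩ := exists_ppar L.joins.1 B.2 hE F
  rw [add_eq_of_ppar (C := ⟨C, hC⟩) hm hml hEm hE hF h1 h]
  exact h

theorem point_zero_add (A : L.Point) : 0 + A = A := by
  obtain ⟨E, hE, h⟩ := add_spec 0 A
  exact Subtype.ext (sumAt_zero_left L.joins.1 L.zero_mem A.2 hE h)

theorem point_add_zero (A : L.Point) : A + 0 = A := by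
  obtain ⟨E, hE, h⟩ := add_spec A 0
  exact Subtype.ext
    ((sumAt_eq_left_iff L.joins.1 L.zero_mem L.zero_mem hE A.2 h).2 rfl)

theorem point_add_assoc (A B C : L.Point) : A + B + C = A + (B + C) := by
  obtain ⟨E, hE⟩ := 𝒜.exists_off L.joins.1
  obtain ⟨m, hm, hEm, hml⟩ := 𝒜.exists_parallelAt L.joins.1 E
  have off : ∀ X ∈ m, X ∉ L.line := fun X h1 h2 => hE (par_eq hml h1 h2 ▸ hEm)
  obtain ⟨F, hF, hBF⟩ := exists_mem_parallel hm hml hEm hE B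
  -- The summand `A` is constructed with the auxiliary point `F` in place of `E`.
  obtain ⟨G, hG, hAG⟩ := exists_mem_parallel hm hml hF (off F hF) A
  have key : ∀ X : L.Point, 𝒜.PPar X.1 E (A + (B + X)).1 G := fun X =>
    (ppar_add hm hml hEm hE hF hBF X).trans (ppar_add hm hml hF (off F hF) hG hAG (B + X))
      (ne_of_off (B + X).2 (off F hF))
  have h0 := key 0
  rw [point_add_zero] at h0
  exact add_eq_of_ppar hm hml hEm hE hG h0 (key C)

theorem point_neg_add_cancel (A : L.Point) : -A + A = 0 := by
  rw [← point_add_zero (-A + A), ← add_neg_self (-A), point_add_assoc, ← point_add_assoc A,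
    add_neg_self, point_zero_add]

/-- The points of `ℓ^{OI}` under the geometric addition, negation and subtraction. -/
noncomputable instance : AddGroup L.Point where
  add_assoc := point_add_assoc
  zero_add := point_zero_add
  add_zero := point_add_zero
  neg_add_cancel := point_neg_add_cancel
  sub_eq_add_neg _ _ := rfl
  nsmul := nsmulRec
  zsmul := zsmulRec

/-! ### Commutativity -/

/-- The point `X` marks the position of the second auxiliary point on the parallel through the
first one; the four conditions on `X` exclude the positions in which a triangle degenerates. -/
theorem point_add_comm_of_exists {A B X : L.Point} (hA : A ≠ 0) (hB : B ≠ 0) (hX : X ≠ 0)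
    (hXB : X ≠ B) (hXA : X + A ≠ 0) (hXAB : X + A ≠ B) : A + B = B + A := by
  have hl := L.joins.1
  have hO := L.zero_mem
  have hAO : A.1 ≠ L.O := fun h => hA (Subtype.ext h)
  have hBO : B.1 ≠ L.O := fun h => hB (Subtype.ext h)
  obtain ⟨H, hH⟩ := 𝒜.exists_off hl
  obtain ⟨m, hm, hHm, hml⟩ := 𝒜.exists_parallelAt hl H
  have off : ∀ {Y}, Y ∈ m → Y ∉ L.line := fun h1 h2 => hH (par_eq hml h1 h2 ▸ hHm)
  obtain ⟨H', hH', hBH⟩ := exists_mem_parallel hm hml hHm hH B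
  obtain ⟨E, hEm, hXE⟩ := exists_mem_parallel hm hml hHm hH X
  have hC := ppar_add hm hml hHm hH hH' hBH A
  have hXAE := ppar_add hm hml hHm hH hEm hXE A
  have hE := off hEm
  have hEH : E ≠ H := by
    rintro rfl
    exact hX (Subtype.ext (eq_of_ppar hl hO hE X.2 hO hXE (ppar_self (ne_of_off hO hE))))
  have hH'H : H' ≠ H := by
    rintro rfl
    exact hBO (eq_of_ppar hl hO hH B.2 hO hBH (ppar_self (ne_of_off hO hH)))
  have hEH' : E ≠ H' := by
    rintro rfl
    exact hXB (Subtype.ext (eq_of_ppar hl hO hH X.2 B.2 hXE hBH))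
  -- A line that meets `L.line` meets `m` at most once.
  have once : ∀ {k : Set α} {Y Z W : α}, k ∈ 𝒜.lines → Y ∈ k → Y ∈ L.line → Z ∈ k → Z ∈ m →
      W ∈ k → W ∈ m → Z = W := by
    intro k Y Z W hk h1 h2 h3 h4 h5 h6
    by_contra hne
    have := 𝒜.line_eq hk hm hne h3 h5 h4 h6
    subst this
    exact off h1 h2
  obtain ⟨oh, hoh, -, oh1, oh2⟩ := 𝒜.exists_line (ne_of_off hO hH)
  obtain ⟨bh, hbh, bh1, bh2⟩ := 𝒜.exists_parallelAt hoh B.1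
  have bh3 : H' ∈ bh := hBH.unfold_left hoh hbh (ne_of_off hO hH) oh1 oh2 bh1 (par_symm bh2)
  obtain ⟨ee, hee, ee1, ee2⟩ := 𝒜.exists_parallelAt hoh E
  obtain ⟨a, ha, -, a1, a2⟩ := 𝒜.exists_line (ne_of_off A.2 hH)
  obtain ⟨c, hc, c1, c2⟩ := 𝒜.exists_parallelAt ha H'
  have c3 : (B + A).1 ∈ c :=
    hC.swap.unfold_left ha hc (ne_of_off A.2 hH).symm a2 a1 c1 (par_symm c2)
  obtain ⟨oe, hoe, -, oe1, oe2⟩ := 𝒜.exists_line (ne_of_off hO hE)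
  obtain ⟨he, hhe, he1, he2⟩ := 𝒜.exists_parallelAt hoe H
  obtain ⟨ae, hae, ae1, ae2⟩ := 𝒜.exists_parallelAt hoe A.1
  have nHoe : H ∉ oe := fun h => hEH (once hoe oe1 hO oe2 hEm h hHm)
  have nEoh : E ∉ oh := fun h => hEH (once hoh oh1 hO h hEm oh2 hHm)
  have np1 : ¬ Parallel oe oh := fun h => nEoh (par_eq h oe1 oh1 ▸ oe2)
  have np2 : ¬ Parallel oe a := fun h => hXA (Subtype.ext
    (eq_of_ppar hl A.2 hH (X + A).2 hO hXAE ⟨a, oe, ha, hoe, a1, a2, oe1, oe2, par_symm h⟩))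
  -- `E'` is the image of `E` under the translation `O → H`.
  obtain ⟨E', e1, e2⟩ : ∃ E', E' ∈ ee ∧ E' ∈ he := exists_meet fun h => np1
    (𝒜.par_trans hoe hhe hoh (par_symm he2) (𝒜.par_trans hhe hee hoh (par_symm h) ee2))
  obtain ⟨d, hd, d1, d2⟩ := 𝒜.exists_parallelAt ha E'
  -- `F` is the image of `E'` under the translation `H → A`.
  obtain ⟨F, f1, f2⟩ : ∃ F, F ∈ d ∧ F ∈ ae := exists_meet fun h => np2
    (𝒜.par_trans hoe hae ha (par_symm ae2) (𝒜.par_trans hae hd ha (par_symm h) d2))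
  have nBoh : B.1 ∉ oh := fun h => hH (𝒜.line_eq hoh hl hBO h oh1 B.2 hO ▸ oh2)
  have nEbh : E ∉ bh := fun h => hEH' (once hbh bh1 B.2 h hEm bh3 hH')
  have nee : bh ≠ ee := fun h => nEbh (h ▸ ee1)
  have step1 : 𝒜.PPar B.1 E H' E' := by
    refine 𝒜.desargues.of_parallel (B := L.O) (B' := H) hbh hoh hee (par_symm bh2)
      (𝒜.par_trans hee hoh hbh ee2 (par_symm bh2)) (fun h => nBoh (h ▸ bh1))
      (fun h => nEoh (h ▸ ee1)) nee bh1 bh3 oh1 oh2 ee1 e1 ?_ ?_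
    · exact ⟨L.line, m, hl, hm, B.2, hO, hH', hHm, par_symm hml⟩
    · exact ⟨oe, he, hoe, hhe, oe1, oe2, he1, e2, par_symm he2⟩
  have hH'E' : H' ≠ E' := by
    rintro rfl
    exact nee (par_eq (𝒜.par_trans hbh hoh hee bh2 (par_symm ee2)) bh3 e1)
  have hE'H : E' ≠ H := by
    rintro rfl
    exact nEoh (par_eq ee2 e1 oh2 ▸ ee1)
  have nE'a : E' ∉ a := fun h => by
    have := 𝒜.line_eq hhe ha hE'H e2 he1 h a2
    subst this
    exact np2 (par_symm he2)
  have nE'c : E' ∉ c := fun h => hXAB (Subtype.ext (eq_of_ppar hl A.2 hH (X + A).2 B.2 hXAE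
    (PPar.trans ⟨a, c, ha, hc, a1, a2, c1, h, par_symm c2⟩ step1.symm hH'E')))
  have step2 : 𝒜.PPar H' E' (B + A).1 F := by
    refine 𝒜.desargues.of_parallel (B := H) (B' := A.1) hc ha hd (par_symm c2)
      (𝒜.par_trans hd ha hc d2 (par_symm c2))
      (fun h => hH'H (once ha a1 A.2 (h ▸ c1) hH' a2 hHm))
      (fun h => nE'a (h ▸ d1)) (fun h => nE'c (h ▸ d1)) c1 c3 a2 a1 d1 f1 ?_ ?_
    · exact ⟨m, L.line, hm, hl, hH', hHm, (B + A).2, A.2, hml⟩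
    · exact ⟨he, ae, hhe, hae, he1, e2, ae1, f2, 𝒜.par_trans hhe hoe hae he2 (par_symm ae2)⟩
  have step3 : 𝒜.PPar L.O A.1 E F := by
    refine 𝒜.desargues.of_parallel (B := H) (B' := E') hoe hhe hae he2 ae2
      (fun h => nHoe (h ▸ he1)) (fun h => ?_) (fun h => ?_) oe1 oe2 he1 e2 ae1 f2 ?_ ?_
    · have := 𝒜.line_eq hhe ha (ne_of_off A.2 hH) (h ▸ ae1) he1 a1 a2
      exact np2 (par_symm (this ▸ he2))
    · exact hE (𝒜.line_eq hoe hl hAO (h ▸ ae1) oe1 A.2 hO ▸ oe2)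
    · exact ⟨oh, ee, hoh, hee, oh1, oh2, ee1, e1, par_symm ee2⟩
    · exact ⟨a, d, ha, hd, a2, a1, d1, f1, par_symm d2⟩
  have hFm : F ∈ m := step3.unfold_left hl hm hAO.symm hO A.2 hEm (par_symm hml)
  exact add_eq_of_ppar hm hml hEm hE hFm
    ⟨oe, ae, hoe, hae, oe1, oe2, ae1, f2, par_symm ae2⟩ (step1.trans step2 hH'E')

theorem point_add_comm (A B : L.Point) : A + B = B + A := by
  by_cases hA : A = 0
  · simp [hA]
  by_cases hB : B = 0
  · simp [hB]
  by_contra hne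
  have small : ∀ X : L.Point, X = 0 ∨ X = B ∨ X + A = 0 ∨ X + A = B := by
    intro X
    by_contra! h
    exact hne (point_add_comm_of_exists hA hB h.1 h.2.1 h.2.2.1 h.2.2.2)
  -- `X = A` forces `A + A = 0`; then `X = A + B` leaves only `A + B + A = B`.
  have hAA : A + A = 0 := by
    rcases small A with h | h | h | h
    · exact absurd h hA
    · exact absurd (by rw [h]) hne
    · exact h
    · exact absurd (by rw [← h, add_assoc]) hne
  rcases small (A + B) with h | h | h | h
  · exact hne (by rw [h, add_eq_zero_iff_eq_neg.1 h, add_neg_cancel])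
  · exact hA (by simpa using h)
  · exact hB (by simpa using (add_right_cancel (h.trans hAA.symm) : A + B = A))
  · exact hne (add_right_cancel (b := A) (by rw [h, add_assoc, hAA, add_zero]))

/-! ### Invariance of the ratio -/

theorem translation_sub_translation (P A C : L.Point) :
    naturalTranslation P A - naturalTranslation P C = A - C := by
  change P + A - (P + C) = A - C
  rw [point_add_comm P A, point_add_comm P C, add_sub_add_right_eq_sub]

theorem ratio_congr {A B C A' B' C' : L.Point} (h : B ≠ C) (h' : B' ≠ C') (hA : A' - C' = A - C)
    (hB : B' - C' = B - C) : ratio A' B' C' h' = ratio A B C h := by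
  unfold ratio
  have hinv : ∀ {X Y : L.Point} (hX : X ≠ 0) (hY : Y ≠ 0), X = Y → inv X hX = inv Y hY := by
    rintro X _ hX hY rfl
    rfl
  exact congrArg₂ (· * ·) (hinv _ _ hB) hA

end OILine

theorem mainTheorem7 {α : Type u} (𝒜 : DesarguesPlane α) (L : OILine 𝒜)
    (P A B C : L.Point) (h : B ≠ C) :
    ∃ h' : OILine.naturalTranslation P B ≠ OILine.naturalTranslation P C,
      OILine.ratio (OILine.naturalTranslation P A) (OILine.naturalTranslation P B)
        (OILine.naturalTranslation P C) h' = OILine.ratio A B C h :=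
  ⟨fun e => h (add_left_cancel e), OILine.ratio_congr h _
    (OILine.translation_sub_translation P A C) (OILine.translation_sub_translation P B C)⟩
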